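/- Let $E\to M$ be a smooth real vector bundle of finite rank over a smooth manifold, equipped with a smooth fibrewise non-degenerate symmetric bilinear form $\langle\cdot,\cdot\rangle$, and let $\Gamma(E)$ be its space of smooth sections. For $p\ge 1$, a $p$-ary pre-Courant structure is an $\mathbb R$-multilinear map $C:\Gamma(E)^p\to\Gamma(E)$ for which there is a map $\sigma_C:\Gamma(E)^{p-1}\to\mathfrak X(M)$ (the symbol) such that, for all sections, $$\sigma_C(e_1,\dots,e_{p-1})\cdot\langle e,e'\rangle=\langle C(e_1,\dots,e_{p-1},e),e'\rangle+\langle e,C(e_1,\dots,e_{p-1},e')\rangle$$ and, for $1\le i\le p-1$, $$\langle C(\dots,e_i,e_{i+1},\dots)+C(\dots,e_{i+1},e_i,\dots),e\rangle=\sigma_C(e_1,\dots,\widehat{e_i},\widehat{e_{i+1}},\dots,e_p,e)\cdot\langle e_i,e_{i+1}\rangle .$$ A $0$-ary pre-Courant structure is a section of $E$. Let $\mathcal C^{p+1}(E)$ be the space of $p$-ary pre-Courant structures and $\mathcal C^0(E)=C^\infty(M)$. For $e\in\Gamma(E)$ and $C\in\mathcal C^{n}(E)$, $n\ge2$, let $\imath_eC=C(e,\cdot,\dots,\cdot)\in\mathcal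 C^{n-1}(E)$. The Keller--Waldmann bracket $[\cdot,\cdot]_{KW}:\mathcal C^n(E)\times\mathcal C^m(E)\to\mathcal C^{n+m-2}(E)$, for $n,m\ge1$, is given by $[e,e']_{KW}=\langle e,e'\rangle$ for $e,e'\in\Gamma(E)$, by $[e,C]_{KW}=(-1)^{n+1}[C,e]_{KW}=\imath_eC$ for $e\in\Gamma(E)$ and $C\in\mathcal C^n(E)$, $n\ge 2$, and recursively by $$\imath_e[C_1,C_2]_{KW}=[\imath_eC_1,C_2]_{KW}+(-1)^n[C_1,\imath_eC_2]_{KW},\qquad C_1\in\mathcal C^n(E),\ C_2\in\mathcal C^m(E),\ n,m\ge2 .$$ An element $C\in\mathcal C^n(E)$, $n\ge2$, is a multi-Courant structure if $[C,C]_{KW}=0$. **Proposition.** Let $n\ge 2$ be odd and $C\in\mathcal C^n(E)$. Then $C$ is a multi-Courant structure if and only if, for all $e_1,\dots,e_{2n-3}\in\Gamma(E)$, $$\sum_{k=n-1}^{2n-3}\ \sum_{\tau\in Sh(k-(n-1),\,n-2)}\operatorname{sgn}(\tau)\,(-1)^{nk}\,C\big(e_{\tau(1)},\dots,e_{\tau(k-(n-1))},\,C(e_{\tau(k-(n-2))},\dots,e_{\tau(k-1)},e_k),\,e_{k+1},\dots,e_{2n-3}\big)=0,$$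 where $Sh(i,j)$ is the set of permutations $\tau$ of $\{1,\dots,i+j\}$ with $\tau(1)<\dots<\tau(i)$ and $\tau(i+1)<\dots<\tau(i+j)$. -/

import Mathlib

open Bundle Manifold
open scoped ContDiff

universe uM uV

noncomputable section

namespace KellerWaldmann

section Geometry

variable {EM : Type*} [NormedAddCommGroup EM] [NormedSpace ℝ EM]
  {H : Type*} [TopologicalSpace H] (I : ModelWithCorners ℝ EM H)
  {M : Type uM} [TopologicalSpace M] [ChartedSpace H M] [IsManifold I ∞ M]
  (F : Type*) [NormedAddCommGroup F] [NormedSpace ℝ F]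
  (V : M → Type uV) [TopologicalSpace (TotalSpace F V)] [∀ x, AddCommGroup (V x)]
  [∀ x, Module ℝ (V x)] [∀ x, TopologicalSpace (V x)] [FiberBundle F V] [VectorBundle ℝ F V]

/-- The space `Γ(E)` of smooth sections of the vector bundle `E → M` with fibres `V x`. -/
abbrev Sec := ContMDiffSection I F ∞ V

/-- The space `𝔛(M)` of smooth vector fields on `M`. -/
abbrev VField (M : Type*) [TopologicalSpace M] [ChartedSpace H M] [IsManifold I ∞ M] :=
  ContMDiffSection I EM ∞ (TangentSpace I : M → Type _)

/-- The algebra `C^∞(M)`. -/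
abbrev SmoothFun (M : Type*) [TopologicalSpace M] [ChartedSpace H M] :=
  ContMDiffMap I 𝓘(ℝ, ℝ) M ℝ ∞

variable {I} in
/-- The value at `x` of the derivative `X · f` of the function `f` along the vector field `X`. -/
def VField.deriv (X : VField I M) (f : SmoothFun I M) (x : M) : ℝ :=
  mfderiv I 𝓘(ℝ, ℝ) f x (X x)

/-- A smooth fibrewise non-degenerate symmetric bilinear form on the bundle `E`. -/
structure FibreMetric where
  form : ∀ x, V x →ₗ[ℝ] V x →ₗ[ℝ] ℝ
  symm : ∀ x v w, form x v w = form x w v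
  nondegenerate : ∀ x v, (∀ w, form x v w = 0) → v = 0
  smooth : ∀ s t : Sec I F V, ContMDiff I 𝓘(ℝ, ℝ) ∞ (fun x => form x (s x) (t x))

variable {I F V}

/-- The function `⟨s, t⟩ ∈ C^∞(M)` for sections `s, t` of `E`. -/
def FibreMetric.pair (g : FibreMetric I F V) (s t : Sec I F V) : SmoothFun I M :=
  ⟨fun x => g.form x (s x) (t x), g.smooth s t⟩

/-- The first condition on a bracket `C` of arity `q + 1` with symbol `σ`:
`σ(e₁,…,e_q)·⟨u, w⟩ = ⟨C(e₁,…,e_q,u), w⟩ + ⟨u, C(e₁,…,e_q,w)⟩`. -/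
def IsMetricSymbol (g : FibreMetric I F V) {q : ℕ}
    (C : MultilinearMap ℝ (fun _ : Fin (q + 1) => Sec I F V) (Sec I F V))
    (σ : (Fin q → Sec I F V) → VField I M) : Prop :=
  ∀ (e : Fin q → Sec I F V) (u w : Sec I F V) (x : M),
    (σ e).deriv (g.pair u w) x =
      g.pair (C (Fin.snoc e u)) w x + g.pair u (C (Fin.snoc e w)) x

/-- The second family of conditions, on a bracket `C` of arity `q + 2` with symbol `σ`:
`⟨C(…,e_i,e_{i+1},…) + C(…,e_{i+1},e_i,…), u⟩ = σ(…,ê_i,ê_{i+1},…,u)·⟨e_i, e_{i+1}⟩`.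
The positions `i` and `i + 1` are `i.castSucc` and `i.succ`; the latter is position `i` in the
tuple from which `e_i` has been removed. -/
def IsSwapSymbol (g : FibreMetric I F V) {q : ℕ}
    (C : MultilinearMap ℝ (fun _ : Fin (q + 2) => Sec I F V) (Sec I F V))
    (σ : (Fin (q + 1) → Sec I F V) → VField I M) : Prop :=
  ∀ (i : Fin (q + 1)) (e : Fin (q + 2) → Sec I F V) (u : Sec I F V) (x : M),
    g.pair (C e + C (e ∘ Equiv.swap i.castSucc i.succ)) u x =
      (σ (Fin.snoc (fun j : Fin q => e (i.castSucc.succAbove (i.succAbove j))) u)).deriv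
        (g.pair (e i.castSucc) (e i.succ)) x

/-- The multilinear `p`-bracket `C` on `Γ(E)` admits a symbol (no condition for `p = 0`). -/
def HasSymbol (g : FibreMetric I F V) : {p : ℕ} →
    MultilinearMap ℝ (fun _ : Fin p => Sec I F V) (Sec I F V) → Prop
  | 0, _ => True
  | 1, C => ∃ σ, IsMetricSymbol g C σ
  | _ + 2, C => ∃ σ, IsMetricSymbol g C σ ∧ IsSwapSymbol g C σ

/-- The `p`-ary pre-Courant structures on `(E, ⟨·,·⟩)`, i.e. the space `𝒞^{p+1}(E)`. A `0`-ary
structure is a section of `E`. -/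
structure PreCourant (g : FibreMetric I F V) (p : ℕ) where
  toMap : MultilinearMap ℝ (fun _ : Fin p => Sec I F V) (Sec I F V)
  hasSymbol : HasSymbol g toMap

lemma HasSymbol.curryLeft {g : FibreMetric I F V} {p : ℕ}
    {C : MultilinearMap ℝ (fun _ : Fin (p + 1) => Sec I F V) (Sec I F V)}
    (hC : HasSymbol g C) (e : Sec I F V) : HasSymbol g (C.curryLeft e) := by
  have key : ∀ {q : ℕ} {C : MultilinearMap ℝ (fun _ : Fin (q + 2) => Sec I F V) (Sec I F V)}
      {σ : (Fin (q + 1) → Sec I F V) → VField I M}, IsMetricSymbol g C σ →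
      IsMetricSymbol g (C.curryLeft e) (fun v => σ (Fin.cons e v)) := by
    intro q C σ h v u w x
    have := h (Fin.cons e v) u w x
    simpa [MultilinearMap.curryLeft_apply, Fin.cons_snoc_eq_snoc_cons] using this
  match p, C, hC with
  | 0, _, _ => trivial
  | 1, _, ⟨σ, h1, _⟩ => exact ⟨_, key h1⟩
  | q + 2, C, ⟨σ, h1, h2⟩ =>
    refine ⟨fun v => σ (Fin.cons e v), key h1, ?_⟩
    intro i v u x
    have h := h2 i.succ (Fin.cons e v) u x
    have e1 : (Fin.cons e v : Fin (q + 3) → Sec I F V) ∘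
        Equiv.swap i.succ.castSucc i.succ.succ =
        Fin.cons e (v ∘ Equiv.swap i.castSucc i.succ) := by
      funext j
      refine Fin.cases ?_ (fun j => ?_) j
      · rw [Function.comp_apply, Equiv.swap_apply_of_ne_of_ne]
        · rfl
        · exact fun h => absurd (congrArg Fin.val h) (by simp)
        · exact fun h => absurd (congrArg Fin.val h) (by simp)
      · simp only [Function.comp_apply, Fin.cons_succ, Equiv.swap_apply_def, Fin.ext_iff,
          Fin.val_succ, Fin.val_castSucc]
        split_ifs with h1 h2 h3 h4 <;> first | omega | rfl
    have e2 : (fun j : Fin (q + 1) => (Fin.cons e v : Fin (q + 3) → Sec I F V)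
        (i.succ.castSucc.succAbove (i.succ.succAbove j))) =
        Fin.cons e (fun j : Fin q => v (i.castSucc.succAbove (i.succAbove j))) := by
      funext j
      refine Fin.cases ?_ (fun j => ?_) j
      · simp
      · simp
    rw [e1, e2, ← Fin.cons_snoc_eq_snoc_cons] at h
    exact h

namespace PreCourant

variable {g : FibreMetric I F V}

/-- The section of `E` which a `0`-ary structure is. -/
def toSec (C : PreCourant g 0) : Sec I F V := C.toMap Fin.elim0

/-- The interior product `ι_e C`, `(ι_e C)(e₁, …, e_p) = C(e, e₁, …, e_p)`. -/
def interior {p : ℕ} (e : Sec I F V) (C : PreCourant g (p + 1)) : PreCourant g p :=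
  ⟨C.toMap.curryLeft e, C.hasSymbol.curryLeft e⟩

end PreCourant

variable (I F V) in
/-- Maps of degree `k`: smooth functions for `k = 0` (in the universe of the brackets), and `p`-ary brackets on `Γ(E)` for
`k = p + 1`. The space `𝒞^k(E)` consists of those which are multilinear and admit a symbol; in
particular `0 ∈ 𝒞^k(E)` is the zero function or the zero bracket. -/
def Raw : ℕ → Type (max uM uV)
  | 0 => ULift.{uV} (SmoothFun I M)
  | p + 1 => (Fin p → Sec I F V) → Sec I F V

instance Raw.instZero : (k : ℕ) → Zero (Raw I F V k)
  | 0 => inferInstanceAs (Zero (ULift.{uV} (SmoothFun I M)))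
  | p + 1 => inferInstanceAs (Zero ((Fin p → Sec I F V) → Sec I F V))

/-- Evaluation of a map of degree `k ≥ 1` on `k - 1` sections (`0` for `k = 0`, a case which the
recursion below does not use). -/
def Raw.eval : {k : ℕ} → Raw I F V k → (Fin (k - 1) → Sec I F V) → Sec I F V
  | 0, _, _ => 0
  | _ + 1, D, v => D v

/-- The Keller-Waldmann bracket `[C₁, C₂]` of `C₁ ∈ 𝒞^n(E)` and `C₂ ∈ 𝒞^m(E)`, where `n = p + 1`
and `m = q + 1`, of degree `n + m - 2 = p + q`. It is given by
* `[e, e'] = ⟨e, e'⟩` for sections `e, e'`,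
* `[e, C] = ι_e C = (-1)^{n+1} [C, e]` for a section `e` and `C` of degree `n`,
* `ι_e [C₁, C₂] = [ι_e C₁, C₂] + (-1)^n [C₁, ι_e C₂]` where `n` is the degree of `C₁`.
When both degrees are positive, arguments of degree `0` (functions) do not occur in the recursion,
because it stops as soon as one argument is a section. -/
def kwBracket {g : FibreMetric I F V} : {p q : ℕ} →
    PreCourant g p → PreCourant g q → Raw I F V (p + q)
  | 0, 0, C₁, C₂ => ULift.up (g.pair C₁.toSec C₂.toSec)
  | 0, q + 1, C₁, C₂ => fun v : Fin (0 + q) → Sec I F V =>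
      (C₂.interior C₁.toSec).toMap (fun i => v (i.cast (Nat.zero_add _).symm))
  | p + 1, 0, C₁, C₂ => fun v : Fin p → Sec I F V =>
      (-1 : ℝ) ^ ((p + 2) + 1) • (C₁.interior C₂.toSec).toMap v
  | p + 1, q + 1, C₁, C₂ => fun v : Fin (p + 1 + q) → Sec I F V =>
      (kwBracket (C₁.interior (v ⟨0, by omega⟩)) C₂).eval
          (fun i => v ⟨i.1 + 1, by have := i.2; omega⟩) +
        (-1 : ℝ) ^ (p + 2) • (kwBracket C₁ (C₂.interior (v ⟨0, by omega⟩))).eval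
          (fun i => v ⟨i.1 + 1, by have := i.2; omega⟩)
  termination_by p q => p + q

/-- `C` is a multi-Courant structure: `[C, C]_{KW} = 0`. -/
def IsMultiCourant {g : FibreMetric I F V} {p : ℕ} (C : PreCourant g p) : Prop :=
  kwBracket C C = 0

end Geometry

open Classical in
/-- The `(i, j)`-unshuffles: the permutations `τ` of `i + j` elements with
`τ(1) < ⋯ < τ(i)` and `τ(i+1) < ⋯ < τ(i+j)`. -/
def unshuffles (i j : ℕ) : Finset (Equiv.Perm (Fin (i + j))) :=
  {τ | StrictMono (τ ∘ Fin.castAdd j) ∧ StrictMono (τ ∘ Fin.natAdd i)}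

section Nested

variable {S : Type*}

/-- For `τ` a permutation of `k - 1` elements, `k - 1 = t + (n - 2)`, and `e = (e₁, e₂, …)`, the
`(n-1)`-tuple `(e_{τ(t+1)}, …, e_{τ(k-1)}, e_k)`. (Elements of `Fin` count from `0`, hence the
shifts by one.) -/
def innerArgs (n k t : ℕ) (τ : Equiv.Perm (Fin (t + (n - 2)))) (e : ℕ → S) : Fin (n - 1) → S :=
  fun j => if h : j.1 < n - 2 then e ((τ (Fin.natAdd t ⟨j.1, h⟩)).1 + 1) else e k

/-- For `τ` as above, and `c : S`, the `(n-1)`-tuple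
`(e_{τ(1)}, …, e_{τ(t)}, c, e_{k+1}, …, e_{2n-3})`. -/
def outerArgs (n k t : ℕ) (τ : Equiv.Perm (Fin (t + (n - 2)))) (e : ℕ → S) (c : S) :
    Fin (n - 1) → S :=
  fun j => if h : j.1 < t then e ((τ (Fin.castAdd (n - 2) ⟨j.1, h⟩)).1 + 1)
    else if j.1 = t then c else e (k + (j.1 - t))

end Nested

end KellerWaldmann

end

/-! For arities `p`, `q` and degrees `n = p + 1`, `m = q + 1`, not both arities zero, the bracket
has the closed form `[C₁, C₂] = N(C₁, C₂) - (-1)^(n m) N(C₂, C₁)`, where `N` (`nestedSum`) is the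
signed sum over unshuffles of all nestings of the first map into the second (`kwBracket_eval`). This
is proved by induction along the recursion defining the bracket: by `nestedSum_succ_succ`, `N` obeys
the same rule `ι_e N(f₁, f₂) = N(ι_e f₁, f₂) + (-1)^n N(f₁, ι_e f₂)`. That rule is Pascal's rule for
unshuffles (`shuffleSum_succ_succ`): the smallest value must open one of the two blocks, so the
first section is the first argument either of the outer map or of the inner one. When `C₁ = C₂` has
odd degree, `(-1)^(n n) = -1`, so the two terms add up to `2 N(C, C)`, which vanishes exactly when
`N(C, C)` does. Finally `k = n - 1 + i` turns the stated sum into `N(C, C)`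
(`sum_unshuffles_eq_nestedSum`). -/

open Equiv
namespace KellerWaldmann

/-! ### Unshuffles and the position of the smallest value -/

/-- The permutations of `Fin n` which are increasing on the first `i` elements and on the
remaining ones. -/
def shuffles (n i : ℕ) : Finset (Perm (Fin n)) :=
  {τ | ∀ a b : Fin n, a < b → (b.1 < i ∨ i ≤ a.1) → τ a < τ b}

lemma mem_shuffles {n i : ℕ} {τ : Perm (Fin n)} :
    τ ∈ shuffles n i ↔ ∀ a b : Fin n, a < b → (b.1 < i ∨ i ≤ a.1) → τ a < τ b := by
  simp [shuffles]

lemma unshuffles_eq (i j : ℕ) : unshuffles i j = shuffles (i + j) i := by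
  ext τ
  simp only [unshuffles, Finset.mem_filter, Finset.mem_univ, true_and, mem_shuffles]
  constructor
  · rintro ⟨h1, h2⟩ a b hab (h | h)
    · exact h1 (a := ⟨a, by omega⟩) (b := ⟨b, h⟩) hab
    · have := h2 (a := ⟨a.1 - i, by omega⟩) (b := ⟨b.1 - i, by omega⟩)
        (by simp only [Fin.lt_def] at hab ⊢; omega)
      simp only [Function.comp_apply] at this
      rwa [show Fin.natAdd i ⟨a.1 - i, by omega⟩ = a from Fin.ext (by simp; omega),
        show Fin.natAdd i ⟨b.1 - i, by omega⟩ = b from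
          Fin.ext (by simp only [Fin.lt_def] at hab; simp; omega)] at this
  · refine fun h => ⟨fun a b hab => h _ _ (by simp only [Fin.lt_def] at hab ⊢; exact hab) (Or.inl (by simp)),
      fun a b hab => h _ _ (by simp only [Fin.lt_def, Fin.val_natAdd] at hab ⊢; omega) (Or.inr (by simp))⟩

/-- The permutation of `Fin (n + 1)` sending `c` to `0`, and acting as `τ` on the other elements. -/
def insertZero {n : ℕ} (c : Fin (n + 1)) (τ : Perm (Fin n)) : Perm (Fin (n + 1)) :=
  Perm.decomposeFin.symm (0, τ) * c.cycleRange

@[simp] lemma insertZero_self {n : ℕ} (c : Fin (n + 1)) (τ : Perm (Fin n)) :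
    insertZero c τ c = 0 := by
  simp [insertZero]

@[simp] lemma insertZero_succAbove {n : ℕ} (c : Fin (n + 1)) (τ : Perm (Fin n)) (a : Fin n) :
    insertZero c τ (c.succAbove a) = (τ a).succ := by
  simp [insertZero]

/-- `c.cycleRange` is a cycle of length `c + 1`, and fixing `0` does not change the sign of `τ`. -/
lemma sign_insertZero {n : ℕ} (c : Fin (n + 1)) (τ : Perm (Fin n)) :
    Perm.sign (insertZero c τ) = (-1) ^ (c : ℕ) * Perm.sign τ := by
  simp [insertZero, Perm.sign_mul, Fin.sign_cycleRange, mul_comm]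

lemma insertZero_injective {n : ℕ} (c : Fin (n + 1)) : Function.Injective (insertZero c) := by
  intro τ τ' h
  ext a
  have := congrArg (fun σ => σ (c.succAbove a)) h
  simp only [insertZero_succAbove] at this
  rw [Fin.succ_injective _ this]

lemma exists_insertZero {n : ℕ} {c : Fin (n + 1)} {σ : Perm (Fin (n + 1))} (h : σ c = 0) :
    ∃ τ, insertZero c τ = σ := by
  obtain ⟨⟨p, τ⟩, hτ⟩ := Perm.decomposeFin.symm.surjective (σ * c.cycleRange⁻¹)
  have hp : p = 0 := by
    have := congrArg (fun σ => σ 0) hτ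
    simpa [Perm.mul_apply, Perm.inv_def, h] using this
  subst hp
  exact ⟨τ, by simp [insertZero, hτ]⟩

/-- The smallest value at the start of a block imposes no condition. The two alternatives in `h` say
that `c` opens the first block, which then shrinks by one, or the second, leaving the first
unchanged. -/
lemma insertZero_mem_shuffles {n m i : ℕ} {c : Fin (n + 1)} {τ : Perm (Fin n)}
    (h : c.1 = 0 ∧ m = i + 1 ∨ c.1 = m ∧ m = i) :
    insertZero c τ ∈ shuffles (n + 1) m ↔ τ ∈ shuffles n i := by
  simp only [mem_shuffles]
  have hval : ∀ a : Fin n, (c.succAbove a).1 = if a.1 < c.1 then a.1 else a.1 + 1 := by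
    intro a
    simp only [Fin.succAbove, Fin.lt_def, Fin.val_castSucc]
    split_ifs <;> simp
  constructor
  · intro H a b hab hi
    have := H (c.succAbove a) (c.succAbove b) (by simpa using hab) (by
      have ha := hval a
      have hb := hval b
      have : a.1 < b.1 := hab
      split_ifs at ha hb <;> omega)
    simpa using this
  · intro H a b
    induction a using Fin.succAboveCases c with
    | x =>
      induction b using Fin.succAboveCases c with
      | x => simp
      | p b => simp
    | p a =>
      induction b using Fin.succAboveCases c with
      | x =>
        intro hab hi
        have ha := hval a
        have : (c.succAbove a).1 < c.1 := hab
        split_ifs at ha <;> omega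
      | p b =>
        intro hab hi
        simp only [insertZero_succAbove, Fin.succ_lt_succ_iff]
        refine H a b (by simpa using hab) ?_
        have ha := hval a
        have hb := hval b
        have : (c.succAbove a).1 < (c.succAbove b).1 := hab
        split_ifs at ha hb <;> omega

/-! ### Alternating sums over unshuffles and their Pascal rule -/

section Sums

variable {A : Type*} [AddCommGroup A]

lemma sum_filter_shuffles {n m i : ℕ} {c : Fin (n + 1)}
    (h : c.1 = 0 ∧ m = i + 1 ∨ c.1 = m ∧ m = i) (f : Perm (Fin (n + 1)) → A) :
    ∑ σ ∈ shuffles (n + 1) m with σ c = 0, f σ = ∑ τ ∈ shuffles n i, f (insertZero c τ) := by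
  symm
  refine Finset.sum_nbij (insertZero c) ?_ (insertZero_injective c).injOn ?_ fun _ _ => rfl
  · intro τ hτ
    simp [insertZero_mem_shuffles h, hτ]
  · intro σ hσ
    simp only [Finset.coe_filter, Set.mem_ofPred_eq] at hσ
    obtain ⟨τ, rfl⟩ := exists_insertZero hσ.2
    exact ⟨τ, (insertZero_mem_shuffles h).1 hσ.1, rfl⟩

/-- The action of a permutation of `Fin n` on `ℕ`. -/
def extendNat {n : ℕ} (τ : Perm (Fin n)) (a : ℕ) : ℕ := if h : a < n then τ ⟨a, h⟩ else a

/-- The sequence obtained from `1 + t` by inserting `0` in position `c`. -/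
def insertZeroNat (c : ℕ) (t : ℕ → ℕ) (a : ℕ) : ℕ :=
  if a < c then t a + 1 else if a = c then 0 else t (a - 1) + 1

lemma extendNat_insertZero {n : ℕ} (c : Fin (n + 1)) (τ : Perm (Fin n)) :
    extendNat (insertZero c τ) = insertZeroNat c (extendNat τ) := by
  funext a
  by_cases ha : a < n + 1
  · obtain ⟨a, rfl⟩ : ∃ a' : Fin (n + 1), a'.1 = a := ⟨⟨a, ha⟩, rfl⟩
    rw [extendNat, dif_pos ha]
    induction a using Fin.succAboveCases c with
    | x => simp [insertZeroNat]
    | p a =>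
      simp only [insertZero_succAbove, Fin.val_succ, insertZeroNat, Fin.eta]
      rcases lt_or_ge a.1 c.1 with h | h
      · rw [Fin.succAbove_of_castSucc_lt _ _ h]
        simp [h, extendNat]
      · rw [Fin.succAbove_of_le_castSucc _ _ h]
        simp [extendNat, show ¬ a.1 + 1 < c.1 by omega, show ¬ a.1 + 1 = c.1 by omega]
  · have := c.2
    simp only [extendNat, dif_neg ha, insertZeroNat, if_neg (show ¬ a < c.1 by omega),
      if_neg (show ¬ a = c.1 by omega), dif_neg (show ¬ a - 1 < n by omega)]
    omega

/-- The alternating sum over `(i, n - i)`-unshuffles. -/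
def shuffleSum (n i : ℕ) (Φ : (ℕ → ℕ) → A) : A :=
  ∑ τ ∈ shuffles n i, (Perm.sign τ : ℤ) • Φ (extendNat τ)

lemma sum_insertZero (n i : ℕ) (c : Fin (n + 1)) (Φ : (ℕ → ℕ) → A) :
    ∑ τ ∈ shuffles n i, (Perm.sign (insertZero c τ) : ℤ) • Φ (extendNat (insertZero c τ)) =
      (-1 : ℤ) ^ (c : ℕ) • shuffleSum n i (fun t => Φ (insertZeroNat c t)) := by
  rw [shuffleSum, Finset.smul_sum]
  refine Finset.sum_congr rfl fun τ _ => ?_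
  rw [sign_insertZero, extendNat_insertZero, smul_smul]
  simp

lemma shuffleSum_zero (Φ : (ℕ → ℕ) → A) : shuffleSum 0 0 Φ = Φ id := by
  have h : shuffles 0 0 = {1} := by
    ext τ
    simp [mem_shuffles, Subsingleton.elim τ 1]
  have h' : extendNat (1 : Perm (Fin 0)) = id := by
    funext a
    simp [extendNat]
  simp [shuffleSum, h, h']

lemma shuffleSum_succ_zero (n : ℕ) (Φ : (ℕ → ℕ) → A) :
    shuffleSum (n + 1) 0 Φ = shuffleSum n 0 (fun t => Φ (insertZeroNat 0 t)) := by
  have h : shuffles (n + 1) 0 = (shuffles (n + 1) 0).filter (fun σ => σ 0 = 0) := by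
    refine (Finset.filter_true_of_mem fun σ hσ => ?_).symm
    by_contra h0
    have hne : σ.symm 0 ≠ 0 := fun h => h0 (by rw [← h, Equiv.apply_symm_apply, h])
    have := mem_shuffles.1 hσ 0 (σ.symm 0) (Fin.pos_iff_ne_zero.2 hne) (Or.inr (by simp))
    simp at this
  rw [shuffleSum, h, sum_filter_shuffles (i := 0) (Or.inr (by simp)), sum_insertZero]
  simp

lemma shuffleSum_succ_self (n : ℕ) (Φ : (ℕ → ℕ) → A) :
    shuffleSum (n + 1) (n + 1) Φ = shuffleSum n n (fun t => Φ (insertZeroNat 0 t)) := by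
  have h : shuffles (n + 1) (n + 1) =
      (shuffles (n + 1) (n + 1)).filter (fun σ => σ 0 = 0) := by
    refine (Finset.filter_true_of_mem fun σ hσ => ?_).symm
    by_contra h0
    have hne : σ.symm 0 ≠ 0 := fun h => h0 (by rw [← h, Equiv.apply_symm_apply, h])
    have := mem_shuffles.1 hσ 0 (σ.symm 0) (Fin.pos_iff_ne_zero.2 hne) (Or.inl (Fin.isLt _))
    simp at this
  rw [shuffleSum, h, sum_filter_shuffles (i := n) (Or.inl (by simp)), sum_insertZero]
  simp

/-- Both blocks are nonempty, so the value `0` sits at position `0` or `i + 1`; moving it from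
position `i + 1` to the front costs the sign `(-1)^(i + 1)`. -/
lemma shuffleSum_succ_succ {n i : ℕ} (hi : i < n) (Φ : (ℕ → ℕ) → A) :
    shuffleSum (n + 1) (i + 1) Φ = shuffleSum n i (fun t => Φ (insertZeroNat 0 t)) +
      (-1 : ℤ) ^ (i + 1) • shuffleSum n (i + 1) (fun t => Φ (insertZeroNat (i + 1) t)) := by
  set c : Fin (n + 1) := ⟨i + 1, by omega⟩ with hc
  -- A preimage of `0` that does not open its block would be preceded in that block by a smaller
  -- value.
  have h : (shuffles (n + 1) (i + 1)).filter (fun σ => ¬ σ 0 = 0) =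
      (shuffles (n + 1) (i + 1)).filter (fun σ => σ c = 0) := by
    refine Finset.filter_congr fun σ hσ => ?_
    constructor
    · intro h0
      have hne : σ.symm 0 ≠ 0 := fun h => h0 (by rw [← h, Equiv.apply_symm_apply, h])
      by_contra hc0
      have hne' : σ.symm 0 ≠ c := fun h => hc0 (by rw [← h, Equiv.apply_symm_apply])
      rcases lt_or_ge (σ.symm 0).1 (i + 1) with hlt | hge
      · have := mem_shuffles.1 hσ 0 (σ.symm 0) (Fin.pos_iff_ne_zero.2 hne) (Or.inl hlt)
        simp at this
      · have := mem_shuffles.1 hσ c (σ.symm 0) (lt_of_le_of_ne hge hne'.symm) (Or.inr le_rfl)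
        simp at this
    · intro h1 h2
      have := σ.injective (h1.trans h2.symm)
      exact absurd (congrArg Fin.val this) (by simp [hc])
  rw [shuffleSum, ← Finset.sum_filter_add_sum_filter_not _ (fun σ => σ 0 = 0), h,
    sum_filter_shuffles (i := i) (Or.inl (by simp)), sum_insertZero,
    sum_filter_shuffles (i := i + 1) (Or.inr (by simp [hc])), sum_insertZero]
  simp [hc]

end Sums

/-! ### Nestings of one map into another and their recursion -/

section Nested

variable {S : Type*}

/-- The sequence `(x, u₀, u₁, …)`. -/
def seqCons (x : S) (u : ℕ → S) : ℕ → S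
  | 0 => x
  | a + 1 => u a

/-- `f₂(w₀, …, w_{i-1}, f₁(w_i, …), w_{i+p}, …)`, where `p` is the number of arguments of `f₁`. -/
def insertComp (p i : ℕ) (f₁ f₂ : (ℕ → S) → S) (w : ℕ → S) : S :=
  f₂ (fun j => if j < i then w j else if j = i then f₁ (fun l => w (i + l)) else w (j + p - 1))

lemma insertComp_insertZeroNat_zero (p i : ℕ) (f₁ f₂ : (ℕ → S) → S) (e : ℕ → S) (t : ℕ → ℕ) :
    insertComp (p + 1) (i + 1) f₁ f₂ (e ∘ insertZeroNat 0 t) =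
      insertComp (p + 1) i f₁ (fun u => f₂ (seqCons (e 0) u)) ((fun a => e (a + 1)) ∘ t) := by
  unfold insertComp
  congr 1
  funext j
  cases j with
  | zero => simp [seqCons, insertZeroNat]
  | succ j =>
    have h : ∀ l, i + 1 + l - 1 = i + l := fun l => by omega
    simp [seqCons, insertZeroNat, h]

lemma insertComp_insertZeroNat_self (p i : ℕ) (f₁ f₂ : (ℕ → S) → S) (e : ℕ → S) (t : ℕ → ℕ) :
    insertComp (p + 1) i f₁ f₂ (e ∘ insertZeroNat i t) =
      insertComp p i (fun u => f₁ (seqCons (e 0) u)) f₂ ((fun a => e (a + 1)) ∘ t) := by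
  unfold insertComp
  congr 1
  funext j
  rcases lt_trichotomy j i with h | h | h
  · simp [h, insertZeroNat]
  · subst h
    simp only [lt_irrefl, if_false, if_true]
    congr 1
    funext l
    cases l with
    | zero => simp [seqCons, insertZeroNat]
    | succ l =>
      simp [seqCons, insertZeroNat]
  · simp only [Function.comp_apply, insertZeroNat, if_neg (show ¬ j < i by omega),
      if_neg (show ¬ j = i by omega), if_neg (show ¬ j + (p + 1) - 1 < i by omega),
      if_neg (show ¬ j + (p + 1) - 1 = i by omega)]
    congr 3

variable [AddCommGroup S]

/-- The sum of all nestings of `f₁` (with `p` arguments) into `f₂` (with `q` arguments). -/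
def nestedSum : (p q : ℕ) → (f₁ f₂ : (ℕ → S) → S) → (ℕ → S) → S
  | 0, _, f₁, f₂, e => insertComp 0 0 f₁ f₂ e
  | p + 1, q, f₁, f₂, e => ∑ i ∈ Finset.range q, (-1 : ℤ) ^ ((p + 2) * i) •
      shuffleSum (p + i) i (fun t => insertComp (p + 1) i f₁ f₂ (e ∘ t))

lemma nestedSum_succ_zero (p : ℕ) (f₁ f₂ : (ℕ → S) → S) (e : ℕ → S) :
    nestedSum (p + 1) 0 f₁ f₂ e = 0 := by
  simp [nestedSum]

lemma insertZeroNat_zero_id : insertZeroNat 0 id = id := by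
  funext a
  cases a <;> simp [insertZeroNat]

lemma shuffleSum_self (n : ℕ) {A : Type*} [AddCommGroup A] (Φ : (ℕ → ℕ) → A) :
    shuffleSum n n Φ = Φ id := by
  induction n generalizing Φ with
  | zero => exact shuffleSum_zero Φ
  | succ n ih =>
    rw [shuffleSum_succ_self, ih, insertZeroNat_zero_id]

lemma neg_one_pow_congr {a b : ℕ} (h : a % 2 = b % 2) : (-1 : ℤ) ^ a = (-1) ^ b := by
  rw [neg_one_pow_eq_pow_mod_two, h, ← neg_one_pow_eq_pow_mod_two]

/-- The terms split according to whether `e 0` enters `f₁` or `f₂` directly; this is the recursion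
of the bracket. -/
lemma nestedSum_succ_succ (p q : ℕ) (f₁ f₂ : (ℕ → S) → S) (e : ℕ → S) :
    nestedSum (p + 1) (q + 1) f₁ f₂ e =
      nestedSum p (q + 1) (fun u => f₁ (seqCons (e 0) u)) f₂ (fun a => e (a + 1)) +
      (-1 : ℤ) ^ (p + 2) •
        nestedSum (p + 1) q f₁ (fun u => f₂ (seqCons (e 0) u)) (fun a => e (a + 1)) := by
  cases p with
  | zero =>
    -- A unary `f₁` receives no shuffled argument, so only the identity contributes: `e 0` enters
    -- `f₁` for `i = 0`, and `f₂` otherwise.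
    simp only [nestedSum, Finset.sum_range_succ', zero_add, shuffleSum_self, Function.comp_id]
    rw [add_comm]
    congr 1
    · simp only [mul_zero, pow_zero, one_smul]
      have h := insertComp_insertZeroNat_self 0 0 f₁ f₂ e id
      rwa [insertZeroNat_zero_id, Function.comp_id, Function.comp_id] at h
    · simp only [pow_mul, even_two.neg_one_pow, one_pow, one_smul]
      refine Finset.sum_congr rfl fun i _ => ?_
      have h := insertComp_insertZeroNat_zero 0 i f₁ f₂ e id
      rwa [insertZeroNat_zero_id, Function.comp_id, Function.comp_id] at h
  | succ p =>
    simp only [nestedSum, Finset.sum_range_succ', Finset.smul_sum]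
    have key : ∀ i, (-1 : ℤ) ^ ((p + 1 + 2) * (i + 1)) • shuffleSum (p + 1 + (i + 1)) (i + 1)
          (fun t => insertComp (p + 1 + 1) (i + 1) f₁ f₂ (e ∘ t)) =
        (-1 : ℤ) ^ ((p + 2) * (i + 1)) • shuffleSum (p + (i + 1)) (i + 1)
          (fun t => insertComp (p + 1) (i + 1) (fun u => f₁ (seqCons (e 0) u)) f₂
            ((fun a => e (a + 1)) ∘ t)) +
        (-1 : ℤ) ^ (p + 1 + 2) • (-1 : ℤ) ^ ((p + 1 + 2) * i) • shuffleSum (p + 1 + i) i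
          (fun t => insertComp (p + 1 + 1) i f₁ (fun u => f₂ (seqCons (e 0) u))
            ((fun a => e (a + 1)) ∘ t)) := by
      intro i
      rw [show p + 1 + (i + 1) = (p + 1 + i) + 1 by omega, shuffleSum_succ_succ (by omega),
        smul_add, add_comm, smul_smul, smul_smul, ← pow_add, ← pow_add,
        show p + 1 + i = p + (i + 1) by omega]
      simp only [insertComp_insertZeroNat_zero, insertComp_insertZeroNat_self]
      congr 2
      -- Moving `e 0` past `i + 1` arguments compensates for the drop by one in the degree of `f₁`.
      · exact neg_one_pow_congr (by
          rw [show (p + 1 + 2) * (i + 1) + (i + 1) = (p + 2) * (i + 1) + 2 * (i + 1) by ring]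
          omega)
      · congr 1
        ring
    rw [Finset.sum_congr rfl fun i _ => key i, Finset.sum_add_distrib]
    -- The remaining term `i = 0` has an empty first block, so `e 0` can only enter `f₁`.
    simp only [mul_zero, pow_zero, one_smul, add_zero, shuffleSum_succ_zero,
      insertComp_insertZeroNat_self]
    abel

end Nested

/-! ### Closed form of the Keller-Waldmann bracket -/

section Bracket

variable {EM : Type*} [NormedAddCommGroup EM] [NormedSpace ℝ EM]
  {H : Type*} [TopologicalSpace H] {I : ModelWithCorners ℝ EM H}
  {M : Type*} [TopologicalSpace M] [ChartedSpace H M] [IsManifold I ∞ M]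
  {F : Type*} [NormedAddCommGroup F] [NormedSpace ℝ F]
  {V : M → Type*} [TopologicalSpace (TotalSpace F V)] [∀ x, AddCommGroup (V x)]
  [∀ x, Module ℝ (V x)] [∀ x, TopologicalSpace (V x)] [FiberBundle F V] [VectorBundle ℝ F V]
  {g : FibreMetric I F V}

/-- The value of a bracket on the first entries of a sequence. -/
noncomputable def PreCourant.onSeq {p : ℕ} (C : PreCourant g p) (u : ℕ → Sec I F V) : Sec I F V :=
  C.toMap (fun j => u j)

lemma PreCourant.onSeq_interior {p : ℕ} (C : PreCourant g (p + 1)) (x : Sec I F V) :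
    (C.interior x).onSeq = fun u => C.onSeq (seqCons x u) := by
  funext u
  simp only [onSeq, interior, MultilinearMap.curryLeft_apply]
  congr 1
  funext j
  refine Fin.cases rfl (fun j => rfl) j

lemma neg_one_pow_smul_int {A : Type*} [AddCommGroup A] [Module ℝ A] (k : ℕ) (x : A) :
    (-1 : ℝ) ^ k • x = (-1 : ℤ) ^ k • x := by
  rcases Nat.even_or_odd k with h | h <;> simp [h.neg_one_pow]

lemma nestedSum_zero_onSeq (q : ℕ) (C : PreCourant g 0) (f : (ℕ → Sec I F V) → Sec I F V)
    (e : ℕ → Sec I F V) : nestedSum 0 q C.onSeq f e = f (seqCons C.toSec e) := by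
  simp only [nestedSum, insertComp]
  congr 1
  funext j
  cases j with
  | zero => exact congrArg C.toMap (Subsingleton.elim _ _)
  | succ j => simp [seqCons]

/-- If one argument is a section, only the nesting of that section into the other map survives.
Otherwise both nested sums satisfy the recursion of the bracket. -/
lemma kwBracket_eval {p q : ℕ} (C₁ : PreCourant g p) (C₂ : PreCourant g q) (hpq : 0 < p + q)
    (e : ℕ → Sec I F V) :
    (kwBracket C₁ C₂).eval (fun i => e i) = nestedSum p q C₁.onSeq C₂.onSeq e -
      (-1 : ℤ) ^ ((p + 1) * (q + 1)) • nestedSum q p C₂.onSeq C₁.onSeq e := by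
  induction p, q, C₁, C₂ using kwBracket.induct generalizing e with
  | case1 C₁ C₂ => simp at hpq
  | case2 q C₁ C₂ =>
    have h : (kwBracket C₁ C₂).eval (fun i => e i) =
        (C₂.interior C₁.toSec).onSeq e := by
      rw [kwBracket]
      rfl
    rw [h, PreCourant.onSeq_interior, nestedSum_succ_zero, smul_zero, sub_zero, nestedSum_zero_onSeq]
  | case3 p C₁ C₂ =>
    have h : (kwBracket C₁ C₂).eval (fun i => e i) =
        (-1 : ℝ) ^ ((p + 2) + 1) • (C₁.interior C₂.toSec).onSeq e := by
      rw [kwBracket]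
      rfl
    rw [h, PreCourant.onSeq_interior, nestedSum_succ_zero, zero_sub, nestedSum_zero_onSeq,
      neg_one_pow_smul_int, ← neg_smul,
      show (-1 : ℤ) ^ (p + 2 + 1) = -(-1) ^ ((p.succ + 1) * (0 + 1)) by
        rw [zero_add, mul_one, pow_succ, mul_neg_one]]
  | case4 p q C₁ C₂ ih₁ ih₂ =>
    have h : (kwBracket C₁ C₂).eval (fun i => e i) =
        (kwBracket (C₁.interior (e 0)) C₂).eval (fun i => e (i + 1)) +
        (-1 : ℝ) ^ (p + 2) • (kwBracket C₁ (C₂.interior (e 0))).eval (fun i => e (i + 1)) := by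
      rw [kwBracket]
      rfl
    have h₁ := ih₁ (fun i => e i) (by omega) (fun a => e (a + 1))
    have h₂ := ih₂ (fun i => e i) (by omega) (fun a => e (a + 1))
    rw [h]
    simp only [PreCourant.onSeq_interior] at h₁ h₂
    rw [h₁, h₂, neg_one_pow_smul_int]
    simp only [Nat.succ_eq_add_one]
    -- The second nested sum expands with the roles of `C₁` and `C₂` exchanged; its sign `(-1)^(q +
    -- 2)` is absorbed by lowering the degree of `C₁` in the prefactor.
    rw [nestedSum_succ_succ, nestedSum_succ_succ, smul_add, smul_smul, ← pow_add, smul_sub,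
      smul_smul, ← pow_add,
      neg_one_pow_congr (show ((p + 1 + 1) * (q + 1 + 1) + (q + 2)) % 2 =
        ((p + 1) * (q + 1 + 1)) % 2 by
          rw [show (p + 1 + 1) * (q + 1 + 1) + (q + 2) = (p + 1) * (q + 1 + 1) + 2 * (q + 2) by
            ring]
          omega),
      show p + 2 + (p + 1 + 1) * (q + 1) = (p + 1 + 1) * (q + 1 + 1) by ring]
    abel

lemma isMultiCourant_iff_nestedSum {p : ℕ} (hp : Odd p) (C : PreCourant g (p + 1)) :
    IsMultiCourant C ↔
      ∀ e : ℕ → Sec I F V, nestedSum (p + 1) (p + 1) C.onSeq C.onSeq e = 0 := by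
  have h2 : ∀ e : ℕ → Sec I F V, (kwBracket C C).eval (fun i => e i) =
      (2 : ℝ) • nestedSum (p + 1) (p + 1) C.onSeq C.onSeq e := by
    intro e
    have hodd : Odd ((p + 1 + 1) * (p + 1 + 1)) := by
      have : Odd (p + 1 + 1) := by obtain ⟨m, rfl⟩ := hp; exact ⟨m + 1, by ring⟩
      exact this.mul this
    rw [kwBracket_eval C C (by omega), hodd.neg_one_pow, neg_one_smul, sub_neg_eq_add, two_smul]
  constructor
  · intro h e
    have he := h2 e
    rw [show kwBracket C C = 0 from h] at he
    exact (smul_eq_zero.1 he.symm).resolve_left two_ne_zero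
  · intro h
    refine funext fun v => ?_
    -- The bracket reads only the first `p + 1 + p` entries, so any padding of `v` would do.
    have he := h2 (fun a => if ha : a < p + 1 + p then v ⟨a, ha⟩ else 0)
    rw [h, smul_zero] at he
    refine Eq.trans ?_ he
    refine congrArg (kwBracket C C) (funext fun i => ?_)
    have hi : i.1 < p + 1 + p := i.2
    simp only [dif_pos hi]

lemma sum_unshuffles_eq_nestedSum {p : ℕ} (C : PreCourant g (p + 1)) (e : ℕ → Sec I F V) :
    ∑ k ∈ Finset.Icc (p + 2 - 1) (2 * (p + 2) - 3),
      ∑ τ ∈ unshuffles (k - (p + 2 - 1)) (p + 2 - 2),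
        ((Perm.sign τ : ℤ) * (-1) ^ ((p + 2) * k)) •
          C.toMap (outerArgs (p + 2) k (k - (p + 2 - 1)) τ e
            (C.toMap (innerArgs (p + 2) k (k - (p + 2 - 1)) τ e))) =
      nestedSum (p + 1) (p + 1) C.onSeq C.onSeq (fun a => e (a + 1)) := by
  set G : ℕ → ℕ → Sec I F V := fun k t => ∑ τ ∈ unshuffles t (p + 2 - 2),
    ((Perm.sign τ : ℤ) * (-1) ^ ((p + 2) * k)) •
      C.toMap (outerArgs (p + 2) k t τ e (C.toMap (innerArgs (p + 2) k t τ e)))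
  change ∑ k ∈ Finset.Icc (p + 2 - 1) (2 * (p + 2) - 3), G k (k - (p + 2 - 1)) = _
  have hI : Finset.Icc (p + 2 - 1) (2 * (p + 2) - 3) = Finset.Ico (p + 1) (p + 1 + (p + 1)) := by
    ext k
    simp only [Finset.mem_Icc, Finset.mem_Ico]
    omega
  rw [hI, Finset.sum_Ico_eq_sum_range, Nat.add_sub_cancel_left, nestedSum]
  refine Finset.sum_congr rfl fun i _ => ?_
  rw [show p + 1 + i - (p + 2 - 1) = i by omega]
  have hpi : p + i = i + p := add_comm p i
  rw [hpi, shuffleSum, Finset.smul_sum]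
  change ∑ τ ∈ unshuffles i p, _ = _
  rw [unshuffles_eq]
  refine Finset.sum_congr rfl fun τ _ => ?_
  rw [smul_smul, mul_comm (Perm.sign τ : ℤ)]
  congr 2
  · refine neg_one_pow_congr ?_
    -- With `n = p + 2` and `k = n - 1 + i`, the exponent `n k` exceeds `n i` by `n (n - 1)`, which
    -- is even.
    have h : Even ((p + 2) * (p + 1)) := by
      rw [mul_comm]; exact Nat.even_mul_succ_self (p + 1)
    obtain ⟨m, hm⟩ := h
    rw [mul_add, hm]
    omega
  · funext j
    have hj : j.1 < p + 1 := j.2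
    have inner : innerArgs (p + 2) (p + 1 + i) i τ e =
        fun l : Fin (p + 1) => e (extendNat τ (i + l) + 1) := by
      funext l
      have hl : l.1 < p + 1 := l.2
      unfold innerArgs
      split_ifs with h
      · rw [extendNat, dif_pos (by omega)]
        rfl
      -- The last inner argument lies beyond the range of `τ`, where `extendNat` is the identity; it
      -- is the unshuffled `e_k`.
      · rw [extendNat, dif_neg (by omega)]
        congr 1
        omega
    rw [inner]
    unfold outerArgs
    beta_reduce
    split_ifs with h h'
    · simp only [Function.comp_apply]
      rw [extendNat, dif_pos (by omega)]
      rfl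
    · rfl
    · simp only [Function.comp_apply]
      rw [extendNat, dif_neg (by omega)]
      congr 1
      omega

end Bracket

end KellerWaldmann

theorem mainTheorem6
    {EM : Type*} [NormedAddCommGroup EM] [NormedSpace ℝ EM] [FiniteDimensional ℝ EM]
    {H : Type*} [TopologicalSpace H] {I : ModelWithCorners ℝ EM H}
    {M : Type*} [TopologicalSpace M] [ChartedSpace H M] [IsManifold I ∞ M]
    [T2Space M] [SigmaCompactSpace M]
    {F : Type*} [NormedAddCommGroup F] [NormedSpace ℝ F] [FiniteDimensional ℝ F]
    {V : M → Type*} [TopologicalSpace (TotalSpace F V)] [∀ x, AddCommGroup (V x)]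
    [∀ x, Module ℝ (V x)] [∀ x, TopologicalSpace (V x)] [FiberBundle F V] [VectorBundle ℝ F V]
    [ContMDiffVectorBundle ∞ F V I]
    (g : KellerWaldmann.FibreMetric I F V)
    (n : ℕ) (hn : Odd n) (hn2 : 2 ≤ n) (C : KellerWaldmann.PreCourant g (n - 1)) :
    KellerWaldmann.IsMultiCourant C ↔
      ∀ e : ℕ → KellerWaldmann.Sec I F V,
        ∑ k ∈ Finset.Icc (n - 1) (2 * n - 3),
          ∑ τ ∈ KellerWaldmann.unshuffles (k - (n - 1)) (n - 2),
            ((Equiv.Perm.sign τ : ℤ) * (-1) ^ (n * k)) •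
              C.toMap (KellerWaldmann.outerArgs n k (k - (n - 1)) τ e
                (C.toMap (KellerWaldmann.innerArgs n k (k - (n - 1)) τ e))) = 0 := by
  obtain ⟨p, rfl⟩ : ∃ p, n = p + 2 := ⟨n - 2, by omega⟩
  have hp : Odd p := by
    rw [Nat.odd_iff] at hn ⊢
    omega
  rw [KellerWaldmann.isMultiCourant_iff_nestedSum hp C]
  constructor
  · intro h e
    rw [KellerWaldmann.sum_unshuffles_eq_nestedSum (p := p) C e]
    exact h _
  · intro h e
    -- This undoes the shift between numbering sections from `1` and from `0`.
    have he := h (fun a => e (a - 1))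
    rw [KellerWaldmann.sum_unshuffles_eq_nestedSum (p := p) C] at he
    exact he
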